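/- Let $G$ be a group and $\varphi$ an automorphism of $G$. Call $g,f\in G$ $\varphi$-twisted conjugate if $\varphi(x)\,g=f\,x$ for some $x\in G$; this is an equivalence relation on $G$, and the number $R(\varphi)\in\mathbb{N}\cup\{\infty\}$ of its classes is the Reidemeister number of $\varphi$. The group $G$ has the $R_\infty$ property if $R(\varphi)=\infty$ for every automorphism $\varphi$ of $G$. For $c\ge 1$ let $N_{2c}=F_2/\gamma_{c+1}(F_2)$ be the free nilpotent group of rank $2$ and class $c$, where $F_2$ is the free group of rank $2$, $\gamma_1(F_2)=F_2$ and $\gamma_{k+1}(F_2)=[\gamma_k(F_2),F_2]$. Then for every integer $c\ge 4$ the group $N_{2c}$ has the $R_\infty$ property. -/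

import Mathlib

/-- Two elements `g`, `f` of `G` are `φ`-twisted conjugate if `φ x * g = f * x` for some `x`. -/
def twistedConjSetoid {G : Type*} [Group G] (φ : G ≃* G) : Setoid G where
  r g f := ∃ x : G, φ x * g = f * x
  iseqv :=
    { refl := fun g => ⟨1, by simp⟩
      symm := by
        rintro g f ⟨x, hx⟩
        refine ⟨x⁻¹, ?_⟩
        rw [map_inv, inv_mul_eq_iff_eq_mul, ← mul_assoc, hx, mul_inv_cancel_right]
      trans := by
        rintro g f h ⟨x, hx⟩ ⟨y, hy⟩
        refine ⟨y * x, ?_⟩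
        rw [map_mul, mul_assoc, hx, ← mul_assoc, hy, mul_assoc] }

/-- The Reidemeister number `R(φ)`: the number of `φ`-twisted conjugacy classes,
as an element of `ℕ ∪ {∞}`. -/
noncomputable def reidemeisterNumber {G : Type*} [Group G] (φ : G ≃* G) : ℕ∞ :=
  ENat.card (Quotient (twistedConjSetoid φ))

/-- `G` has the `R_∞` property: every automorphism of `G` has infinite Reidemeister number. -/
def HasRInfinity (G : Type*) [Group G] : Prop :=
  ∀ φ : G ≃* G, reidemeisterNumber φ = ⊤

/-- The free nilpotent group of rank `r` and class `c`, that is `F_r / γ_{c+1}(F_r)`.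
Mathlib's lower central series is indexed from `0`, so `γ_{c+1}` is its `c`-th term. -/
abbrev FreeNilpotentGroup (r c : ℕ) : Type :=
  FreeGroup (Fin r) ⧸ (⊤ : Subgroup (FreeGroup (Fin r))).lowerCentralSeries c

/-!
Write `γ_k` for the lower central series of the free group `F` on `x, y`, and let `M` be the matrix
of the action of an automorphism `φ` of `F / γ_{c+1}` on the abelianization `ℤ²`, so
`det M = ±1`. If `f` and `g` are `φ`-twisted conjugate by `h`, then `φ(h) g = f h`, so any
`φ`-invariant additive function defined at `f`, `g` and `h` takes the same value at `f` and `g`.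
The eigenvalues `λ, μ` of `M` determine the action of `φ` on the sections of the lower central
series: `λμ` on `γ₂/γ₃`, `λ²μ, λμ²` on `γ₃/γ₄`, and `λ³μ, λ²μ², λμ³` on `γ₄/γ₅`. Three cases exhaust
the possibilities.

* If `1` is an eigenvalue of `M`, there is a nonzero invariant functional on `ℤ²`.
* Otherwise a conjugator `h` between elements of `γ₂` lies in `γ₂`
  (`HasMatrix.mem_lcs_one`). If `det M = 1`, the coordinate `degTwo` on `γ₂/γ₃ ≅ ℤ` is invariant and
  separates the powers of `[x, y]`.
* If `det M = -1` and `1` is not an eigenvalue, then `φ` has no nonzero fixed vector on `γ₂/γ₃` or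
  `γ₃/γ₄` either, so a conjugator between elements of `γ₄` lies in `γ₄`
  (`HasMatrix.mem_lcs_three`). On `γ₄/γ₅` the eigenvalue `λ²μ²` equals `1`, and
  `degFourInvariant` is an explicit nonzero invariant functional.

Here `c ≥ 4` ensures that `γ_{c+1} ≤ γ₅`, so that all these functionals make sense on the quotient.

Coordinates on the sections come from the homomorphisms `affineRep l d` of `F` to the group of maps
`r ↦ u r + m` of the ring `ℤ⟦X⟧`, sending the generators to `r ↦ (1 - lᵢ X) r + dᵢ`. For `k ≥ 1`,
elements of `γ_{k+1}` become translations by multiples of `X ^ k`, and the coefficient of `X ^ k` is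
an additive function `leading l d k` that kills `γ_{k+2}` and satisfies
`leading l d (k + 1) [w, v] = leading l d k w * l(v)`. This recursion determines how these functions
depend on `l` and `d` (`leading_deg_two`, `leading_deg_three`, `leading_deg_four`) and how they
transform under endomorphisms (`leading_map`).
-/

open PowerSeries
open scoped commutatorElement
open FreeGroup (of lift)

/-! ### The affine group of a commutative ring -/

/-- The invertible affine self-maps `r ↦ scale * r + shift` of a commutative ring `R`, multiplied by
composition. -/
@[ext]
structure ScalarAffine (R : Type*) [CommRing R] where
  scale : Rˣ
  shift : R

namespace ScalarAffine

variable {R : Type*} [CommRing R]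

instance : Mul (ScalarAffine R) := ⟨fun f g => ⟨f.scale * g.scale, f.shift + f.scale * g.shift⟩⟩
instance : One (ScalarAffine R) := ⟨⟨1, 0⟩⟩
instance : Inv (ScalarAffine R) := ⟨fun f => ⟨f.scale⁻¹, -(↑f.scale⁻¹ * f.shift)⟩⟩

@[simp] lemma scale_mul (f g : ScalarAffine R) : (f * g).scale = f.scale * g.scale := rfl
@[simp] lemma shift_mul (f g : ScalarAffine R) :
    (f * g).shift = f.shift + f.scale * g.shift := rfl
@[simp] lemma scale_one : (1 : ScalarAffine R).scale = 1 := rfl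
@[simp] lemma shift_one : (1 : ScalarAffine R).shift = 0 := rfl
@[simp] lemma scale_inv (f : ScalarAffine R) : f⁻¹.scale = f.scale⁻¹ := rfl
@[simp] lemma shift_inv (f : ScalarAffine R) : f⁻¹.shift = -(↑f.scale⁻¹ * f.shift) := rfl

instance : Group (ScalarAffine R) :=
  Group.ofLeftAxioms
    (fun f g h => by ext <;> simp [mul_assoc, mul_add, add_assoc])
    (fun f => by ext <;> simp)
    (fun f => by ext <;> simp)

/-- The linear part of an affine map, as a homomorphism. -/
def scaleHom : ScalarAffine R →* Rˣ where
  toFun := scale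
  map_one' := rfl
  map_mul' _ _ := rfl

lemma scale_commutator (f g : ScalarAffine R) : ⁅f, g⁆.scale = 1 := by
  simp [commutatorElement_def]

lemma shift_commutator (f g : ScalarAffine R) :
    ⁅f, g⁆.shift = f.shift * (1 - g.scale) - g.shift * (1 - f.scale) := by
  -- Comparing translation parts here avoids expanding the inverses in the commutator.
  have h : ⁅f, g⁆ * (g * f) = f * g := by simp [commutatorElement_def, mul_assoc]
  have h2 := congrArg shift h
  simp only [shift_mul, scale_commutator, Units.val_one, one_mul] at h2
  linear_combination h2

end ScalarAffine

/-- The unit `1 - a X` of `ℤ⟦X⟧`. -/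
noncomputable def linearUnit (a : ℤ) : ℤ⟦X⟧ˣ :=
  (isUnit_iff_constantCoeff.2 (by simp) : IsUnit (1 - C a * X : ℤ⟦X⟧)).unit

@[simp] lemma val_linearUnit (a : ℤ) : (linearUnit a : ℤ⟦X⟧) = 1 - C a * X := rfl

namespace FreeGroupTwo

/-! ### Exponent sums and the abelianization -/

/-- The homomorphism from the free group of rank two to `ℤ` (written multiplicatively) that counts
the `j`-th generator with sign. -/
noncomputable def exponentHom (j : Fin 2) : FreeGroup (Fin 2) →* Multiplicative ℤ :=
  lift fun i => Multiplicative.ofAdd (if i = j then 1 else 0)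

/-- The exponent sum of the `j`-th generator in `g`. -/
noncomputable def exponentSum (j : Fin 2) (g : FreeGroup (Fin 2)) : ℤ := (exponentHom j g).toAdd

@[simp] lemma exponentSum_one (j : Fin 2) : exponentSum j 1 = 0 := by simp [exponentSum]
@[simp] lemma exponentSum_mul (j : Fin 2) (g h : FreeGroup (Fin 2)) :
    exponentSum j (g * h) = exponentSum j g + exponentSum j h := by simp [exponentSum]
@[simp] lemma exponentSum_inv (j : Fin 2) (g : FreeGroup (Fin 2)) :
    exponentSum j g⁻¹ = -exponentSum j g := by simp [exponentSum]
@[simp] lemma exponentSum_pow (j : Fin 2) (g : FreeGroup (Fin 2)) (n : ℕ) :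
    exponentSum j (g ^ n) = n * exponentSum j g := by simp [exponentSum]
@[simp] lemma exponentSum_of (i j : Fin 2) : exponentSum j (of i) = if i = j then 1 else 0 := by
  simp [exponentSum, exponentHom]

lemma exponentSum_map (Φ : FreeGroup (Fin 2) →* FreeGroup (Fin 2)) (j : Fin 2)
    (g : FreeGroup (Fin 2)) :
    exponentSum j (Φ g) =
      exponentSum j (Φ (of 0)) * exponentSum 0 g + exponentSum j (Φ (of 1)) * exponentSum 1 g := by
  induction g using FreeGroup.induction_on with
  | C1 => simp
  | of i => fin_cases i <;> simp
  | inv_of i h => simp [h]; ring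
  | mul g h hg hh => simp [hg, hh]; ring

lemma exponentSum_of_mem (j : Fin 2) {g : FreeGroup (Fin 2)}
    (hg : g ∈ (⊤ : Subgroup (FreeGroup (Fin 2))).lowerCentralSeries 1) : exponentSum j g = 0 := by
  rw [Subgroup.top_lowerCentralSeries_one] at hg
  have := Abelianization.commutator_subset_ker (exponentHom j) hg
  simpa [exponentSum] using this

/-- The exponent sums are a complete set of coordinates on the abelianization. -/
lemma mem_lowerCentralSeries_one {g : FreeGroup (Fin 2)}
    (h0 : exponentSum 0 g = 0) (h1 : exponentSum 1 g = 0) :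
    g ∈ (⊤ : Subgroup (FreeGroup (Fin 2))).lowerCentralSeries 1 := by
  have key : ∀ w : FreeGroup (Fin 2), Abelianization.of w =
      Abelianization.of (of 0) ^ exponentSum 0 w * Abelianization.of (of 1) ^ exponentSum 1 w := by
    intro w
    induction w using FreeGroup.induction_on with
    | C1 => simp
    | of i => fin_cases i <;> simp
    | inv_of i h => simp only [exponentSum_inv, map_inv, zpow_neg]; rw [h, mul_inv]
    | mul g h hg hh =>
      simp only [exponentSum_mul, map_mul, zpow_add]
      rw [hg, hh, mul_mul_mul_comm]
  have := key g
  rw [h0, h1, zpow_zero, zpow_zero, one_mul, ← MonoidHom.mem_ker, Abelianization.ker_of] at this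
  rwa [Subgroup.top_lowerCentralSeries_one]

/-- The functional on the abelianization `ℤ²` with coefficients `l`, evaluated at the class of
`g`. -/
noncomputable def pairing (l : Fin 2 → ℤ) (g : FreeGroup (Fin 2)) : ℤ :=
  l 0 * exponentSum 0 g + l 1 * exponentSum 1 g

/-! ### Affine representations over power series -/

lemma coeff_zero_mul (p q : ℤ⟦X⟧) : coeff 0 (p * q) = coeff 0 p * coeff 0 q := by
  simp

/-- The affine representation of the free group of rank two over `ℤ⟦X⟧` in which the `i`-th
generator acts by `r ↦ (1 - l i * X) * r + d i`. The minus sign makes `leading_commutator` free of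
signs. -/
noncomputable def affineRep (l d : Fin 2 → ℤ) : FreeGroup (Fin 2) →* ScalarAffine ℤ⟦X⟧ :=
  lift fun i => ⟨linearUnit (l i), C (d i)⟩

/-- The coefficient of `X ^ k` in the translation part of `affineRep l d g`. It is of interest for
`g` in the `k`-th term of the lower central series, where all lower coefficients vanish. -/
noncomputable def leading (l d : Fin 2 → ℤ) (k : ℕ) (g : FreeGroup (Fin 2)) : ℤ :=
  coeff k (affineRep l d g).shift

/-- The linear part of `affineRep l d g` is `1 - pairing l g * X` modulo `X ^ 2`. -/
lemma coeff_scale (l d : Fin 2 → ℤ) (g : FreeGroup (Fin 2)) :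
    coeff 0 ((affineRep l d g).scale : ℤ⟦X⟧) = 1 ∧
      coeff 1 ((affineRep l d g).scale : ℤ⟦X⟧) = - pairing l g := by
  induction g using FreeGroup.induction_on with
  | C1 => simp [pairing, coeff_one]
  | of i => fin_cases i <;> simp [affineRep, pairing, coeff_one]
  | inv_of i h =>
    have h1 : (((affineRep l d (of i)).scale : ℤ⟦X⟧)) * ((affineRep l d (of i)⁻¹).scale : ℤ⟦X⟧)
        = 1 := by simp
    have hp : pairing l (of i)⁻¹ = -pairing l (of i) := by
      simp only [pairing, exponentSum_inv]; ring
    rw [hp]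
    generalize ((affineRep l d (of i)).scale : ℤ⟦X⟧) = p at h h1
    generalize ((affineRep l d (of i)⁻¹).scale : ℤ⟦X⟧) = q at h1
    have e0 := congrArg (coeff 0) h1
    have e1 := congrArg (coeff 1) h1
    rw [coeff_zero_mul, h.1, one_mul, coeff_zero_one] at e0
    rw [coeff_one_mul, ← coeff_zero_eq_constantCoeff_apply, ← coeff_zero_eq_constantCoeff_apply,
      h.1, h.2, e0, coeff_one, if_neg one_ne_zero] at e1
    exact ⟨e0, by linarith⟩
  | mul g h hg hh =>
    simp only [map_mul, ScalarAffine.scale_mul, Units.val_mul, coeff_zero_mul, coeff_one_mul]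
    simp only [← coeff_zero_eq_constantCoeff_apply, hg, hh, pairing, exponentSum_mul]
    exact ⟨by simp, by ring⟩

lemma coeff_shift (l d : Fin 2 → ℤ) (g : FreeGroup (Fin 2)) :
    coeff 0 (affineRep l d g).shift = pairing d g := by
  have hs := fun g => (coeff_scale l d g).1
  induction g using FreeGroup.induction_on with
  | C1 => simp [pairing]
  | of i => fin_cases i <;> simp [affineRep, pairing]
  | inv_of i h =>
    have := hs (of i)⁻¹
    rw [map_inv, ScalarAffine.scale_inv] at this
    rw [map_inv, ScalarAffine.shift_inv, map_neg, coeff_zero_mul, this, h]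
    simp only [pairing, exponentSum_inv]; ring
  | mul g h hg hh =>
    simp only [map_mul, ScalarAffine.shift_mul, map_add, coeff_zero_mul, hg, hs, hh]
    simp only [pairing, exponentSum_mul]; ring

/-! ### Leading coefficients on the lower central series -/

/-- The lower central series of the free group of rank two, indexed from `0`: `lcs k` is the group
usually called `γ_{k+1}`. -/
abbrev lcs (k : ℕ) : Subgroup (FreeGroup (Fin 2)) :=
  (⊤ : Subgroup (FreeGroup (Fin 2))).lowerCentralSeries k

lemma commutator_mem_lcs {k : ℕ} {w : FreeGroup (Fin 2)} (hw : w ∈ lcs k)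
    (v : FreeGroup (Fin 2)) : ⁅w, v⁆ ∈ lcs (k + 1) :=
  Subgroup.commutator_mem_commutator hw (Subgroup.mem_top v)

lemma lcs_le {k m : ℕ} (h : k ≤ m) : lcs m ≤ lcs k :=
  Subgroup.lowerCentralSeries_antitone _ h

lemma map_mem_lcs (Φ : FreeGroup (Fin 2) →* FreeGroup (Fin 2)) {k : ℕ} {w : FreeGroup (Fin 2)}
    (hw : w ∈ lcs k) : Φ w ∈ lcs k := by
  have h : Φ w ∈ (lcs k).map Φ := Subgroup.mem_map_of_mem Φ hw
  rw [Subgroup.map_lowerCentralSeries] at h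
  exact Subgroup.lowerCentralSeries_mono k le_top h

/-- Additive functions on a term of the lower central series are determined by their values on the
commutators that generate it. -/
lemma eqOn_lcs {k : ℕ} {f g : FreeGroup (Fin 2) → ℤ}
    (hf : ∀ u ∈ lcs (k + 1), ∀ v ∈ lcs (k + 1), f (u * v) = f u + f v)
    (hg : ∀ u ∈ lcs (k + 1), ∀ v ∈ lcs (k + 1), g (u * v) = g u + g v)
    (h : ∀ w ∈ lcs k, ∀ v, f ⁅w, v⁆ = g ⁅w, v⁆) {w : FreeGroup (Fin 2)} (hw : w ∈ lcs (k + 1)) :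
    f w = g w := by
  have hf1 := hf 1 (one_mem _) 1 (one_mem _)
  have hg1 := hg 1 (one_mem _) 1 (one_mem _)
  rw [one_mul] at hf1 hg1
  rw [Subgroup.mem_lowerCentralSeries_succ_iff] at hw
  induction hw using Subgroup.closure_induction with
  | mem x hx => obtain ⟨w, hw, v, -, rfl⟩ := hx; exact h w hw v
  | one => linarith
  | mul x y hx hy ex ey => rw [hf x hx y hy, hg x hx y hy, ex, ey]
  | inv x hx ex =>
    have h1 := hf x hx x⁻¹ (inv_mem hx)
    have h2 := hg x hx x⁻¹ (inv_mem hx)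
    rw [mul_inv_cancel] at h1 h2
    linarith

variable (l d : Fin 2 → ℤ)

lemma scale_eq_one {k : ℕ} (hk : 1 ≤ k) {w : FreeGroup (Fin 2)} (hw : w ∈ lcs k) :
    (affineRep l d w).scale = 1 := by
  have h := lcs_le hk hw
  rw [lcs, Subgroup.top_lowerCentralSeries_one] at h
  exact Abelianization.commutator_subset_ker (ScalarAffine.scaleHom.comp (affineRep l d)) h

lemma shift_mul_of_mem {k : ℕ} (hk : 1 ≤ k) {u : FreeGroup (Fin 2)} (hu : u ∈ lcs k)
    (v : FreeGroup (Fin 2)) :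
    (affineRep l d (u * v)).shift = (affineRep l d u).shift + (affineRep l d v).shift := by
  simp [scale_eq_one l d hk hu]

lemma shift_commutator_of_mem {k : ℕ} (hk : 1 ≤ k) {w : FreeGroup (Fin 2)} (hw : w ∈ lcs k)
    (v : FreeGroup (Fin 2)) :
    (affineRep l d ⁅w, v⁆).shift
      = (affineRep l d w).shift * (1 - (affineRep l d v).scale) := by
  rw [map_commutatorElement, ScalarAffine.shift_commutator, scale_eq_one l d hk hw]
  simp

lemma X_dvd_one_sub_scale (v : FreeGroup (Fin 2)) :
    (X : ℤ⟦X⟧) ∣ 1 - (affineRep l d v).scale := by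
  rw [X_dvd_iff, ← coeff_zero_eq_constantCoeff_apply, map_sub, (coeff_scale l d v).1]
  simp

lemma leading_mul {k : ℕ} (hk : 1 ≤ k) (n : ℕ) {u : FreeGroup (Fin 2)} (hu : u ∈ lcs k)
    (v : FreeGroup (Fin 2)) : leading l d n (u * v) = leading l d n u + leading l d n v := by
  rw [leading, shift_mul_of_mem l d hk hu, map_add]; rfl

/-- The key filtration property: each commutator gains a factor `1 - scale`, a multiple of `X`. -/
lemma X_pow_dvd_shift (k : ℕ) {w : FreeGroup (Fin 2)} (hw : w ∈ lcs k) :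
    (X : ℤ⟦X⟧) ^ k ∣ (affineRep l d w).shift := by
  induction k generalizing w with
  | zero => simp
  | succ k ih =>
    rw [lcs, Subgroup.mem_lowerCentralSeries_succ_iff] at hw
    induction hw using Subgroup.closure_induction with
    | mem x hx =>
      obtain ⟨w, hw, v, -, rfl⟩ := hx
      rw [map_commutatorElement, ScalarAffine.shift_commutator, pow_succ]
      refine dvd_sub (mul_dvd_mul (ih hw) (X_dvd_one_sub_scale l d v)) ?_
      -- The second term vanishes for `k ≥ 1`, where `w` acts by a translation.
      rcases Nat.eq_zero_or_pos k with rfl | hk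
      · simpa using Dvd.dvd.mul_left (X_dvd_one_sub_scale l d w) _
      · simp [scale_eq_one l d hk hw]
    | one => simp
    | mul x y hx hy ex ey =>
      rw [shift_mul_of_mem l d (Nat.le_add_left 1 k) hx]
      exact dvd_add ex ey
    | inv x hx ex =>
      rw [map_inv, ScalarAffine.shift_inv]
      exact (dvd_mul_of_dvd_right ex _).neg_right

lemma leading_eq_zero {k n : ℕ} (h : k < n) {w : FreeGroup (Fin 2)} (hw : w ∈ lcs n) :
    leading l d k w = 0 :=
  X_pow_dvd_iff.1 (X_pow_dvd_shift l d n hw) k h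

lemma leading_commutator {k : ℕ} (hk : 1 ≤ k) {w : FreeGroup (Fin 2)} (hw : w ∈ lcs k)
    (v : FreeGroup (Fin 2)) :
    leading l d (k + 1) ⁅w, v⁆ = leading l d k w * pairing l v := by
  obtain ⟨s, hs⟩ := X_pow_dvd_shift l d k hw
  rw [leading, leading, shift_commutator_of_mem l d hk hw, hs, mul_assoc, add_comm k 1,
    coeff_X_pow_mul]
  rw [show coeff k (X ^ k * s) = coeff (0 + k) (X ^ k * s) by rw [zero_add], coeff_X_pow_mul]
  rw [coeff_one_mul, ← coeff_zero_eq_constantCoeff_apply, ← coeff_zero_eq_constantCoeff_apply,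
    map_sub, map_sub, (coeff_scale l d v).1, (coeff_scale l d v).2]
  simp [coeff_one, mul_comm]

lemma leading_one_commutator (u v : FreeGroup (Fin 2)) :
    leading l d 1 ⁅u, v⁆ = pairing d u * pairing l v - pairing d v * pairing l u := by
  have hc := fun g => coeff_scale l d g
  rw [leading, map_commutatorElement, ScalarAffine.shift_commutator, map_sub, coeff_one_mul,
    coeff_one_mul]
  simp only [← coeff_zero_eq_constantCoeff_apply, map_sub, hc, coeff_shift]
  simp [coeff_one]; ring

lemma leading_one {k : ℕ} : leading l d k 1 = 0 := by simp [leading]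

lemma leading_inv {k : ℕ} (hk : 1 ≤ k) (n : ℕ) {w : FreeGroup (Fin 2)} (hw : w ∈ lcs k) :
    leading l d n w⁻¹ = - leading l d n w := by
  have h := leading_mul l d hk n hw w⁻¹
  rw [mul_inv_cancel, leading_one] at h
  linarith

lemma leading_pow {k : ℕ} (hk : 1 ≤ k) (n : ℕ) {w : FreeGroup (Fin 2)} (hw : w ∈ lcs k) (m : ℕ) :
    leading l d n (w ^ m) = m * leading l d n w := by
  induction m with
  | zero => simp [leading_one]
  | succ m ih => rw [pow_succ', leading_mul l d hk n hw, ih]; push_cast; ring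

lemma leading_zpow {k : ℕ} (hk : 1 ≤ k) (n : ℕ) {w : FreeGroup (Fin 2)} (hw : w ∈ lcs k) (m : ℤ) :
    leading l d n (w ^ m) = m * leading l d n w := by
  obtain ⟨m, rfl | rfl⟩ := m.eq_nat_or_neg
  · simp [leading_pow l d hk n hw]
  · rw [zpow_neg, leading_inv l d hk n (zpow_mem hw _)]
    simp [leading_pow l d hk n hw]

/-- The functional `l` on `ℤ²` precomposed with the map induced by the endomorphism `Φ`. -/
noncomputable def pullback (Φ : FreeGroup (Fin 2) →* FreeGroup (Fin 2)) (l : Fin 2 → ℤ) :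
    Fin 2 → ℤ :=
  fun i => pairing l (Φ (of i))

lemma pairing_map (Φ : FreeGroup (Fin 2) →* FreeGroup (Fin 2)) (g : FreeGroup (Fin 2)) :
    pairing l (Φ g) = pairing (pullback Φ l) g := by
  simp only [pairing, pullback, exponentSum_map Φ _ g]; ring

/-- An endomorphism acts on leading coefficients only through its effect on the abelianization. -/
lemma leading_map (Φ : FreeGroup (Fin 2) →* FreeGroup (Fin 2)) (k : ℕ) {w : FreeGroup (Fin 2)}
    (hw : w ∈ lcs (k + 1)) :
    leading l d (k + 1) (Φ w) = leading (pullback Φ l) (pullback Φ d) (k + 1) w := by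
  induction k generalizing w with
  | zero =>
    refine eqOn_lcs (f := fun w => leading l d (0 + 1) (Φ w)) (fun u hu v _ => ?_)
      (fun u hu v _ => leading_mul _ _ le_rfl _ hu v) (fun u _ v => ?_) hw
    · simp only [map_mul]; exact leading_mul l d le_rfl _ (map_mem_lcs Φ hu) _
    · simp only [map_commutatorElement]
      simp only [zero_add, leading_one_commutator, pairing_map]
  | succ k ih =>
    refine eqOn_lcs (f := fun w => leading l d (k + 1 + 1) (Φ w)) (fun u hu v _ => ?_)
      (fun u hu v _ => leading_mul _ _ (by omega) _ hu v) (fun u hu v => ?_) hw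
    · simp only [map_mul]; exact leading_mul l d (by omega) _ (map_mem_lcs Φ hu) _
    · simp only [map_commutatorElement]
      rw [leading_commutator _ _ (by omega) hu, leading_commutator _ _ (by omega)
        (map_mem_lcs Φ hu), ih hu, pairing_map]

/-! ### Coordinates in degrees two, three and four -/

/-- The coordinate on `γ₂/γ₃ ≅ ℤ` that takes the value `1` at `[x, y]`. -/
noncomputable def degTwo : FreeGroup (Fin 2) → ℤ := leading ![1, 0] ![0, -1] 1
/-- The first coordinate on `γ₃/γ₄ ≅ ℤ²`, relative to the basis `[[x, y], x]`, `[[x, y], y]`. -/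
noncomputable def degThreeX : FreeGroup (Fin 2) → ℤ := leading ![1, 0] ![0, -1] 2
/-- The second coordinate on `γ₃/γ₄ ≅ ℤ²`, relative to the basis `[[x, y], x]`, `[[x, y], y]`. -/
noncomputable def degThreeY : FreeGroup (Fin 2) → ℤ := leading ![0, 1] ![1, 0] 2
/-- The coordinate of `[[[x, y], x], x]` on `γ₄/γ₅`. -/
noncomputable def degFourXX : FreeGroup (Fin 2) → ℤ := leading ![1, 0] ![0, -1] 3
/-- The coordinate of `[[[x, y], y], y]` on `γ₄/γ₅`. -/
noncomputable def degFourYY : FreeGroup (Fin 2) → ℤ := leading ![0, 1] ![1, 0] 3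
/-- The coordinate of `[[[x, y], x], y]` on `γ₄/γ₅`, obtained by polarizing the quadratic dependence
of `leading l d 3` on `l`. -/
noncomputable def degFourXY (w : FreeGroup (Fin 2)) : ℤ :=
  leading ![1, 1] ![1, 0] 3 w - degFourXX w - degFourYY w

/-- The coefficient `leading l d 1` depends on `l` and `d` only through their determinant. -/
lemma leading_deg_two {w : FreeGroup (Fin 2)} (hw : w ∈ lcs 1) :
    leading l d 1 w = (d 0 * l 1 - d 1 * l 0) * degTwo w := by
  refine eqOn_lcs (k := 0) (f := leading l d 1)
    (g := fun w => (d 0 * l 1 - d 1 * l 0) * degTwo w)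
    (fun u hu v _ => leading_mul _ _ le_rfl _ hu v) (fun u hu v _ => ?_) (fun u _ v => ?_) hw
  · simp only [degTwo, leading_mul _ _ le_rfl _ hu v]; ring
  · simp only [degTwo, leading_one_commutator, pairing]; simp; ring

lemma leading_deg_three {w : FreeGroup (Fin 2)} (hw : w ∈ lcs 2) :
    leading l d 2 w =
      (d 0 * l 1 - d 1 * l 0) * (l 0 * degThreeX w + l 1 * degThreeY w) := by
  refine eqOn_lcs (k := 1) (f := leading l d 2)
    (g := fun w => (d 0 * l 1 - d 1 * l 0) * (l 0 * degThreeX w + l 1 * degThreeY w))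
    (fun u hu v _ => leading_mul _ _ one_le_two _ hu v) (fun u hu v _ => ?_)
    (fun u hu v => ?_) hw
  · simp only [degThreeX, degThreeY, leading_mul _ _ one_le_two _ hu v]; ring
  · simp only [degThreeX, degThreeY, leading_commutator _ _ le_rfl hu]
    rw [leading_deg_two l d hu, leading_deg_two ![0, 1] _ hu, leading_deg_two ![1, 0] _ hu]
    simp [pairing]; ring

/-- On `γ₄` the leading coefficient is a quadratic form in `l`, scaled by the determinant of `l` and
`d`. -/
lemma leading_deg_four {w : FreeGroup (Fin 2)} (hw : w ∈ lcs 3) :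
    leading l d 3 w = (d 0 * l 1 - d 1 * l 0) *
      (l 0 ^ 2 * degFourXX w + l 0 * l 1 * degFourXY w + l 1 ^ 2 * degFourYY w) := by
  have h1 : 1 ≤ 2 + 1 := by norm_num
  refine eqOn_lcs (k := 2) (f := leading l d 3)
    (g := fun w => (d 0 * l 1 - d 1 * l 0) *
      (l 0 ^ 2 * degFourXX w + l 0 * l 1 * degFourXY w + l 1 ^ 2 * degFourYY w))
    (fun u hu v _ => leading_mul _ _ h1 _ hu v) (fun u hu v _ => ?_)
    (fun u hu v => ?_) hw
  · simp only [degFourXX, degFourXY, degFourYY, leading_mul _ _ h1 _ hu v]; ring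
  · simp only [degFourXX, degFourXY, degFourYY, leading_commutator _ _ one_le_two hu]
    rw [leading_deg_three l d hu, leading_deg_three ![0, 1] _ hu, leading_deg_three ![1, 0] _ hu,
      leading_deg_three ![1, 1] _ hu]
    simp [pairing]; ring

/-! ### Generators of the sections of the lower central series -/

/-- Sections of the lower central series are central, so every subgroup of `γ_{k+1}` that
contains `γ_{k+2}` is normal. -/
lemma normal_sup_lcs {k : ℕ} {K : Subgroup (FreeGroup (Fin 2))} (hK : K ≤ lcs k) :
    (K ⊔ lcs (k + 1)).Normal := by
  have hle : K ⊔ lcs (k + 1) ≤ lcs k := sup_le hK (lcs_le k.le_succ)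
  refine ⟨fun h hh g => ?_⟩
  have h1 : ⁅h, g⁆⁻¹ ∈ K ⊔ lcs (k + 1) :=
    inv_mem (Subgroup.mem_sup_right (commutator_mem_lcs (hle hh) g))
  have h2 : g * h * g⁻¹ = ⁅h, g⁆⁻¹ * h := by simp [commutatorElement_def, mul_assoc]
  rw [h2]
  exact mul_mem h1 hh

/-- Commuting with the images of the two generators suffices to commute with the whole image. -/
lemma commute_of_commute_of {K : Type*} [Group K] (f : FreeGroup (Fin 2) →* K) {k : K}
    (h0 : Commute k (f (of 0))) (h1 : Commute k (f (of 1))) (w : FreeGroup (Fin 2)) :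
    Commute k (f w) := by
  induction w using FreeGroup.induction_on with
  | C1 => simp
  | of i => fin_cases i; exacts [h0, h1]
  | inv_of i h => rw [map_inv]; exact h.inv_right
  | mul g h hg hh => rw [map_mul]; exact hg.mul_right hh

lemma commute_mk_iff {H : Subgroup (FreeGroup (Fin 2))} [H.Normal] (u v : FreeGroup (Fin 2)) :
    Commute (QuotientGroup.mk' H u) (QuotientGroup.mk' H v) ↔ ⁅u, v⁆ ∈ H := by
  rw [← commutatorElement_eq_one_iff_commute, ← map_commutatorElement, ← MonoidHom.mem_ker,
    QuotientGroup.ker_mk']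

lemma commutator_mem_of_commutator_of_mem {H : Subgroup (FreeGroup (Fin 2))} [H.Normal]
    {u : FreeGroup (Fin 2)} (h0 : ⁅u, of 0⁆ ∈ H) (h1 : ⁅u, of 1⁆ ∈ H) (v : FreeGroup (Fin 2)) :
    ⁅u, v⁆ ∈ H :=
  (commute_mk_iff u v).1 (commute_of_commute_of _ ((commute_mk_iff _ _).2 h0)
    ((commute_mk_iff _ _).2 h1) v)

lemma commutator_mem_symm {H : Subgroup (FreeGroup (Fin 2))} {u v : FreeGroup (Fin 2)}
    (h : ⁅u, v⁆ ∈ H) : ⁅v, u⁆ ∈ H := by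
  rw [← commutatorElement_inv]; exact inv_mem h

/-- The commutator `[x, y]` of the two generators, which generates `γ₂` modulo `γ₃`. -/
def basicTwo : FreeGroup (Fin 2) :=
  ⁅(of 0 : FreeGroup (Fin 2)), (of 1 : FreeGroup (Fin 2))⁆

/-- The commutators `[[x, y], x]` and `[[x, y], y]`, which generate `γ₃` modulo `γ₄`. -/
def basicThree (i : Fin 2) : FreeGroup (Fin 2) := ⁅basicTwo, of i⁆

lemma basicTwo_mem : basicTwo ∈ lcs 1 := commutator_mem_lcs (Subgroup.mem_top _) _

lemma basicThree_mem (i : Fin 2) : basicThree i ∈ lcs 2 := commutator_mem_lcs basicTwo_mem _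

/-- Modulo `⟨[x, y]⟩ γ₃` the two generators commute, so the quotient is commutative. -/
lemma lcs_one_le : lcs 1 ≤ Subgroup.zpowers basicTwo ⊔ lcs 2 := by
  have hN := normal_sup_lcs ((Subgroup.zpowers_le).2 basicTwo_mem)
  have hz : ⁅(of 0 : FreeGroup (Fin 2)), of 1⁆ ∈ Subgroup.zpowers basicTwo ⊔ lcs 2 :=
    Subgroup.mem_sup_left (Subgroup.mem_zpowers basicTwo)
  have h0 := commutator_mem_of_commutator_of_mem (u := of 0) (by simp) hz
  have h1 := commutator_mem_of_commutator_of_mem (u := of 1) (commutator_mem_symm hz) (by simp)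
  refine Subgroup.commutator_le.2 fun u _ v _ => ?_
  exact commutator_mem_of_commutator_of_mem (commutator_mem_symm (h0 u))
    (commutator_mem_symm (h1 u)) v

/-- Modulo the group on the right, `[x, y]` is central, and hence so is all of `γ₂`. -/
lemma lcs_two_le : lcs 2 ≤
    Subgroup.zpowers (basicThree 0) ⊔ (Subgroup.zpowers (basicThree 1) ⊔ lcs 3) := by
  rw [← sup_assoc]
  have hN := normal_sup_lcs (sup_le ((Subgroup.zpowers_le).2 (basicThree_mem 0))
    ((Subgroup.zpowers_le).2 (basicThree_mem 1)))
  set H := Subgroup.zpowers (basicThree 0) ⊔ Subgroup.zpowers (basicThree 1) ⊔ lcs (2 + 1)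
  have hz := commutator_mem_of_commutator_of_mem (H := H) (u := basicTwo)
    (Subgroup.mem_sup_left (Subgroup.mem_sup_left (Subgroup.mem_zpowers (basicThree 0))))
    (Subgroup.mem_sup_left (Subgroup.mem_sup_right (Subgroup.mem_zpowers (basicThree 1))))
  refine Subgroup.commutator_le.2 fun u hu v _ => ?_
  obtain ⟨_, ⟨n, rfl⟩, r, hr, rfl⟩ := Subgroup.mem_sup_of_normal_right.1 (lcs_one_le hu)
  rw [← commute_mk_iff, map_mul, map_zpow]
  exact (((commute_mk_iff _ _).2 (hz v)).zpow_left n).mul_left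
    ((commute_mk_iff _ _).2 (Subgroup.mem_sup_right (commutator_mem_lcs hr v)))

@[simp] lemma degTwo_basicTwo : degTwo basicTwo = 1 := by
  simp [degTwo, basicTwo, leading_one_commutator, pairing]

/-- The coordinate `degTwo` is injective on `γ₂/γ₃`. -/
lemma mem_lcs_two {w : FreeGroup (Fin 2)} (hw : w ∈ lcs 1) (h : degTwo w = 0) : w ∈ lcs 2 := by
  obtain ⟨_, ⟨n, rfl⟩, r, hr, rfl⟩ := Subgroup.mem_sup_of_normal_right.1 (lcs_one_le hw)
  have hz := degTwo_basicTwo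
  dsimp only at h
  rw [degTwo] at h hz
  rw [leading_mul _ _ le_rfl _ (zpow_mem basicTwo_mem n), leading_zpow _ _ le_rfl _ basicTwo_mem,
    hz, leading_eq_zero _ _ one_lt_two hr, mul_one, add_zero] at h
  simpa [h] using hr

lemma leading_basicThree (l d : Fin 2 → ℤ) (i : Fin 2) :
    leading l d 2 (basicThree i) = (d 0 * l 1 - d 1 * l 0) * l i := by
  rw [basicThree, leading_commutator _ _ le_rfl basicTwo_mem, leading_deg_two l d basicTwo_mem]
  fin_cases i <;> simp [pairing]

/-- The coordinates `degThreeX` and `degThreeY` are jointly injective on `γ₃/γ₄`. -/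
lemma mem_lcs_three {w : FreeGroup (Fin 2)} (hw : w ∈ lcs 2) (hX : degThreeX w = 0)
    (hY : degThreeY w = 0) : w ∈ lcs 3 := by
  have hN := normal_sup_lcs ((Subgroup.zpowers_le).2 (basicThree_mem 1))
  obtain ⟨_, ⟨n, rfl⟩, _, hr, rfl⟩ := Subgroup.mem_sup_of_normal_right.1 (lcs_two_le hw)
  obtain ⟨_, ⟨m, rfl⟩, r, hr3, rfl⟩ := Subgroup.mem_sup_of_normal_right.1 hr
  have key : ∀ l d : Fin 2 → ℤ, leading l d 2 (basicThree 0 ^ n * (basicThree 1 ^ m * r)) =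
      n * ((d 0 * l 1 - d 1 * l 0) * l 0) + m * ((d 0 * l 1 - d 1 * l 0) * l 1) := by
    intro l d
    rw [leading_mul _ _ one_le_two _ (zpow_mem (basicThree_mem 0) n),
      leading_mul _ _ one_le_two _ (zpow_mem (basicThree_mem 1) m),
      leading_zpow _ _ one_le_two _ (basicThree_mem 0),
      leading_zpow _ _ one_le_two _ (basicThree_mem 1), leading_basicThree, leading_basicThree,
      leading_eq_zero _ _ (Nat.lt_succ_self 2) hr3, add_zero]
  dsimp only at hX hY
  rw [degThreeX, key] at hX
  rw [degThreeY, key] at hY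
  simp at hX hY
  simpa [hX, hY] using hr3

lemma leading_commutator_basicThree (l d : Fin 2 → ℤ) (i j : Fin 2) :
    leading l d 3 ⁅basicThree i, of j⁆ = (d 0 * l 1 - d 1 * l 0) * (l i * l j) := by
  rw [leading_commutator _ _ one_le_two (basicThree_mem i), leading_basicThree]
  fin_cases j <;> simp [pairing] <;> ring

/-! ### The action of an endomorphism on the sections -/

section Invariants

variable {Φ : FreeGroup (Fin 2) →* FreeGroup (Fin 2)} {a b c d : ℤ}

/-- The endomorphism `Φ` acts on the abelianization `ℤ²` (column vectors of exponent sums) by the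
matrix with rows `(a, b)` and `(c, d)`. -/
structure HasMatrix (Φ : FreeGroup (Fin 2) →* FreeGroup (Fin 2)) (a b c d : ℤ) : Prop where
  exponentSum_zero : ∀ g, exponentSum 0 (Φ g) = a * exponentSum 0 g + b * exponentSum 1 g
  exponentSum_one : ∀ g, exponentSum 1 (Φ g) = c * exponentSum 0 g + d * exponentSum 1 g

lemma exists_hasMatrix (Φ : FreeGroup (Fin 2) →* FreeGroup (Fin 2)) :
    ∃ a b c d : ℤ, HasMatrix Φ a b c d :=
  ⟨_, _, _, _, fun g => exponentSum_map Φ 0 g, fun g => exponentSum_map Φ 1 g⟩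

lemma HasMatrix.pullback_eq (h : HasMatrix Φ a b c d) (l : Fin 2 → ℤ) :
    pullback Φ l = ![l 0 * a + l 1 * c, l 0 * b + l 1 * d] := by
  ext i
  fin_cases i <;> simp [pullback, pairing, h.exponentSum_zero, h.exponentSum_one]

lemma HasMatrix.degTwo_map (h : HasMatrix Φ a b c d) {w : FreeGroup (Fin 2)} (hw : w ∈ lcs 1) :
    degTwo (Φ w) = (a * d - b * c) * degTwo w := by
  rw [degTwo, leading_map _ _ _ 0 hw, leading_deg_two _ _ hw]
  simp [h.pullback_eq, degTwo]; left; ring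

lemma HasMatrix.degThreeX_map (h : HasMatrix Φ a b c d) {w : FreeGroup (Fin 2)}
    (hw : w ∈ lcs 2) :
    degThreeX (Φ w) = (a * d - b * c) * (a * degThreeX w + b * degThreeY w) := by
  rw [degThreeX, leading_map _ _ _ 1 hw, leading_deg_three _ _ hw]
  simp [h.pullback_eq, degThreeX]; left; ring

lemma HasMatrix.degThreeY_map (h : HasMatrix Φ a b c d) {w : FreeGroup (Fin 2)}
    (hw : w ∈ lcs 2) :
    degThreeY (Φ w) = (a * d - b * c) * (c * degThreeX w + d * degThreeY w) := by
  rw [degThreeY, leading_map _ _ _ 1 hw, leading_deg_three _ _ hw]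
  simp [h.pullback_eq, degThreeY]

/-- The functional on `γ₄/γ₅` that an endomorphism with matrix `M`, of rows `(a, b)` and `(c, d)`,
multiplies by `(det M) ^ 2`. Functionals on `γ₄/γ₅` correspond, up to a twist by `det`, to symmetric
matrices `S`, with `M` acting by `S ↦ Mᵀ S M`. If `J` has rows `(0, 1)` and `(-1, 0)`, then
`Mᵀ J M = det M • J`, so `S = J (2 M - tr M)` satisfies `Mᵀ S M = det M • S`, and it is symmetric
because `2 M - tr M` has trace zero. The coefficients are the entries of this `S`. -/
noncomputable def degFourInvariant (a b c d : ℤ) (w : FreeGroup (Fin 2)) : ℤ :=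
  2 * c * degFourXX w + (d - a) * degFourXY w - 2 * b * degFourYY w

lemma degFourInvariant_mul (a b c d : ℤ) {u : FreeGroup (Fin 2)} (hu : u ∈ lcs 3)
    (v : FreeGroup (Fin 2)) : degFourInvariant a b c d (u * v) =
      degFourInvariant a b c d u + degFourInvariant a b c d v := by
  have h1 : 1 ≤ 3 := by norm_num
  simp only [degFourInvariant, degFourXX, degFourXY, degFourYY, leading_mul _ _ h1 _ hu]
  ring

lemma degFourInvariant_pow (a b c d : ℤ) {u : FreeGroup (Fin 2)} (hu : u ∈ lcs 3) (n : ℕ) :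
    degFourInvariant a b c d (u ^ n) = n * degFourInvariant a b c d u := by
  have h1 : 1 ≤ 3 := by norm_num
  simp only [degFourInvariant, degFourXX, degFourXY, degFourYY, leading_pow _ _ h1 _ hu]
  ring

lemma degFourInvariant_of_mem (a b c d : ℤ) {u : FreeGroup (Fin 2)} (hu : u ∈ lcs 4) :
    degFourInvariant a b c d u = 0 := by
  have h1 : 3 < 4 := by norm_num
  simp [degFourInvariant, degFourXX, degFourXY, degFourYY, leading_eq_zero _ _ h1 hu]

lemma HasMatrix.degFourInvariant_map (h : HasMatrix Φ a b c d) {w : FreeGroup (Fin 2)}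
    (hw : w ∈ lcs 3) :
    degFourInvariant a b c d (Φ w) = (a * d - b * c) ^ 2 * degFourInvariant a b c d w := by
  have key : ∀ l m : Fin 2 → ℤ, _ := fun l m =>
    (leading_map l m Φ 2 hw).trans (leading_deg_four _ _ hw)
  simp only [h.pullback_eq] at key
  simp only [degFourInvariant]
  generalize hA : degFourXX w = A at *
  generalize hB : degFourXY w = B at *
  generalize hC : degFourYY w = C at *
  rw [degFourXY, degFourXX, degFourYY, key, key, key]
  simp
  ring

/-- If the invariant vanished identically, `M` would be a scalar matrix `a`, and its determinant
`a ^ 2` could not be `-1`. -/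
lemma exists_degFourInvariant_ne_zero (hdet : a * d - b * c = -1) :
    ∃ w ∈ lcs 3, degFourInvariant a b c d w ≠ 0 := by
  have hmem : ∀ i j : Fin 2, ⁅basicThree i, of j⁆ ∈ lcs 3 := fun i j =>
    commutator_mem_lcs (basicThree_mem i) _
  have hval : ∀ i j : Fin 2, degFourInvariant a b c d ⁅basicThree i, of j⁆ = _ := fun i j => by
    simp only [degFourInvariant, degFourXX, degFourXY, degFourYY, leading_commutator_basicThree]
    rfl
  by_contra! hcon
  have h00 := (hval 0 0).symm.trans (hcon _ (hmem 0 0))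
  have h01 := (hval 0 1).symm.trans (hcon _ (hmem 0 1))
  have h11 := (hval 1 1).symm.trans (hcon _ (hmem 1 1))
  simp at h00 h01 h11
  obtain rfl : d = a := by linarith
  rw [h00] at hdet
  nlinarith [mul_self_nonneg d]

end Invariants

end FreeGroupTwo

/-! ### Twisted conjugacy -/

/-- A sequence of pairwise non-conjugate elements makes the Reidemeister number infinite. -/
lemma reidemeisterNumber_eq_top_of_family {G : Type*} [Group G] (φ : G ≃* G) (s : ℕ → G)
    (hs : ∀ m n x, φ x * s m = s n * x → m = n) : reidemeisterNumber φ = ⊤ := by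
  refine (ENat.card_eq_top).2 (Infinite.of_injective
    (fun n => (Quotient.mk (twistedConjSetoid φ) (s n))) fun m n h => ?_)
  obtain ⟨x, hx⟩ := Quotient.exact h
  exact hs m n x hx

namespace FreeGroupTwo

variable {k : ℕ}

/-- Endomorphisms of the free nilpotent group lift to the free group. -/
lemma exists_lift (φ : FreeNilpotentGroup 2 k →* FreeNilpotentGroup 2 k) :
    ∃ Φ : FreeGroup (Fin 2) →* FreeGroup (Fin 2),
      ∀ g, QuotientGroup.mk' (lcs k) (Φ g) = φ (QuotientGroup.mk' (lcs k) g) := by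
  choose r hr using QuotientGroup.mk'_surjective (lcs k)
  refine ⟨lift fun i => r (φ (QuotientGroup.mk' (lcs k) (of i))), fun g => ?_⟩
  refine DFunLike.congr_fun (f := (QuotientGroup.mk' (lcs k)).comp
    (lift fun i => r (φ (QuotientGroup.mk' (lcs k) (of i)))))
    (g := φ.comp (QuotientGroup.mk' (lcs k))) (FreeGroup.ext_hom _ _ fun i => ?_) g
  simp only [MonoidHom.comp_apply, FreeGroup.lift_apply_of, hr]

lemma exists_mul_of_mk_eq {u v : FreeGroup (Fin 2)}
    (h : QuotientGroup.mk' (lcs k) u = QuotientGroup.mk' (lcs k) v) : ∃ r ∈ lcs k, v = u * r :=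
  ⟨u⁻¹ * v, QuotientGroup.eq.1 h, by group⟩

lemma exponentSum_eq_of_mk_eq (hk : 1 ≤ k) (j : Fin 2) {u v : FreeGroup (Fin 2)}
    (h : QuotientGroup.mk' (lcs k) u = QuotientGroup.mk' (lcs k) v) :
    exponentSum j u = exponentSum j v := by
  obtain ⟨r, hr, rfl⟩ := exists_mul_of_mk_eq h
  rw [exponentSum_mul, exponentSum_of_mem j (lcs_le hk hr), add_zero]

/-- The powers of `s` lie in distinct twisted conjugacy classes if some function `T`, additive and
nonzero on them, is constant along twisted conjugacy modulo `γ₅`. -/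
lemma reidemeisterNumber_eq_top_of_invariant (hk : 4 ≤ k)
    {φ : FreeNilpotentGroup 2 k ≃* FreeNilpotentGroup 2 k}
    {Φ : FreeGroup (Fin 2) →* FreeGroup (Fin 2)}
    (hΦ : ∀ g, QuotientGroup.mk' (lcs k) (Φ g) = φ (QuotientGroup.mk' (lcs k) g))
    (s : FreeGroup (Fin 2)) (T : FreeGroup (Fin 2) → ℤ) (hT : ∀ n : ℕ, T (s ^ n) = n * T s)
    (hs : T s ≠ 0)
    (h : ∀ (m n : ℕ) (x r : FreeGroup (Fin 2)), r ∈ lcs 4 → s ^ n * x = Φ x * s ^ m * r →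
      T (s ^ m) = T (s ^ n)) :
    reidemeisterNumber φ = ⊤ := by
  refine reidemeisterNumber_eq_top_of_family φ (fun n => QuotientGroup.mk' (lcs k) (s ^ n))
    fun m n x hx => ?_
  obtain ⟨x, rfl⟩ := QuotientGroup.mk'_surjective _ x
  rw [← hΦ, ← map_mul, ← map_mul] at hx
  obtain ⟨r, hr, hr'⟩ := exists_mul_of_mk_eq hx
  have := h m n x r (lcs_le hk hr) hr'
  rw [hT, hT] at this
  exact_mod_cast mul_right_cancel₀ hs this

/-- A lift of an automorphism acts invertibly on `ℤ²`. The inverse matrix comes from a lift of the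
inverse automorphism. -/
lemma HasMatrix.det_eq {Φ : FreeGroup (Fin 2) →* FreeGroup (Fin 2)} {a b c d : ℤ}
    (h : HasMatrix Φ a b c d) (hk : 1 ≤ k)
    {φ : FreeNilpotentGroup 2 k ≃* FreeNilpotentGroup 2 k}
    (hΦ : ∀ g, QuotientGroup.mk' (lcs k) (Φ g) = φ (QuotientGroup.mk' (lcs k) g)) :
    a * d - b * c = 1 ∨ a * d - b * c = -1 := by
  obtain ⟨Ψ, hΨ⟩ := exists_lift (φ.symm : FreeNilpotentGroup 2 k →* FreeNilpotentGroup 2 k)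
  obtain ⟨a', b', c', d', h'⟩ := exists_hasMatrix Ψ
  have key : ∀ j g, exponentSum j (Ψ (Φ g)) = exponentSum j g := fun j g =>
    exponentSum_eq_of_mk_eq hk j (by rw [hΨ, hΦ]; exact φ.symm_apply_apply _)
  have e00 := key 0 (of 0)
  have e01 := key 0 (of 1)
  have e10 := key 1 (of 0)
  have e11 := key 1 (of 1)
  simp only [h'.exponentSum_zero, h'.exponentSum_one, h.exponentSum_zero, h.exponentSum_one,
    exponentSum_of] at e00 e01 e10 e11
  norm_num at e00 e01 e10 e11
  refine Int.isUnit_iff.1 (IsUnit.of_mul_eq_one (a' * d' - b' * c') ?_)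
  calc (a * d - b * c) * (a' * d' - b' * c')
      = (a' * a + b' * c) * (c' * b + d' * d) - (a' * b + b' * d) * (c' * a + d' * c) := by ring
    _ = 1 := by rw [e00, e01, e10, e11]; norm_num

/-- If `det (M - 1) = 0`, then `M` fixes a nonzero row vector. -/
lemma exists_fixed_functional {a b c d : ℤ} (h : (a - 1) * (d - 1) - b * c = 0) :
    ∃ l : Fin 2 → ℤ, ∃ i, l i ≠ 0 ∧ l 0 * a + l 1 * c = l 0 ∧ l 0 * b + l 1 * d = l 1 := by
  by_cases hc : c = 0
  · by_cases ha : a = 1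
    · by_cases hd : d = 1
      · by_cases hb : b = 0
        · exact ⟨![1, 0], 0, by simp [ha, hb]⟩
        · exact ⟨![0, 1], 1, by simp [hc, hd]⟩
      · exact ⟨![d - 1, -b], 0, by simp [sub_eq_zero, hd], by simp [ha, hc],
          by simp; ring⟩
    · exact ⟨![c, 1 - a], 1, by simp [sub_eq_zero, Ne.symm ha], by simp; ring,
        by simp; linear_combination -h⟩
  · exact ⟨![c, 1 - a], 0, by simpa using hc, by simp; ring, by simp; linear_combination -h⟩

lemma pairing_mul (l : Fin 2 → ℤ) (u v : FreeGroup (Fin 2)) :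
    pairing l (u * v) = pairing l u + pairing l v := by
  simp only [pairing, exponentSum_mul]; ring

lemma pairing_pow (l : Fin 2 → ℤ) (u : FreeGroup (Fin 2)) (n : ℕ) :
    pairing l (u ^ n) = n * pairing l u := by
  simp only [pairing, exponentSum_pow]; ring

lemma pairing_of_mem (l : Fin 2 → ℤ) {u : FreeGroup (Fin 2)} (hu : u ∈ lcs 1) :
    pairing l u = 0 := by
  simp [pairing, exponentSum_of_mem _ hu]

/-- If `1` is not an eigenvalue of `M`, an element conjugating two elements of `γ₂`, in the twisted
sense and modulo `γ₂`, is in `γ₂`: its class in `ℤ²` is a fixed vector of `M`. -/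
lemma HasMatrix.mem_lcs_one {Φ : FreeGroup (Fin 2) →* FreeGroup (Fin 2)} {a b c d : ℤ}
    (h : HasMatrix Φ a b c d) (h1 : (a - 1) * (d - 1) - b * c ≠ 0) {x s t r : FreeGroup (Fin 2)}
    (hs : s ∈ lcs 1) (ht : t ∈ lcs 1) (hr : r ∈ lcs 1) (hx : t * x = Φ x * s * r) :
    x ∈ lcs 1 := by
  have e : ∀ j, exponentSum j x = exponentSum j (Φ x) := fun j => by
    have := congrArg (exponentSum j) hx
    simpa [exponentSum_of_mem j hs, exponentSum_of_mem j ht, exponentSum_of_mem j hr] using this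
  have e0 := e 0
  have e1 := e 1
  rw [h.exponentSum_zero] at e0
  rw [h.exponentSum_one] at e1
  -- Cramer's rule for the system `M v = v`, whose determinant is nonzero by `h1`.
  refine mem_lowerCentralSeries_one ?_ ?_
  · exact (mul_eq_zero.1 (show ((a - 1) * (d - 1) - b * c) * exponentSum 0 x = 0 by
      linear_combination b * e1 - (d - 1) * e0)).resolve_left h1
  · exact (mul_eq_zero.1 (show ((a - 1) * (d - 1) - b * c) * exponentSum 1 x = 0 by
      linear_combination c * e0 - (a - 1) * e1)).resolve_left h1

/-- The effect of the twisted conjugacy equation on leading coefficients. -/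
lemma leading_twisted {Φ : FreeGroup (Fin 2) →* FreeGroup (Fin 2)} (l d : Fin 2 → ℤ) {k n : ℕ}
    (hk : 1 ≤ k) {x s t r : FreeGroup (Fin 2)} (hxk : x ∈ lcs k) (hs : s ∈ lcs k) (ht : t ∈ lcs k)
    (hr : r ∈ lcs (n + 1)) (hx : t * x = Φ x * s * r) :
    leading l d n t + leading l d n x = leading l d n (Φ x) + leading l d n s := by
  have hΦ := map_mem_lcs Φ hxk
  have := congrArg (leading l d n) hx
  rwa [leading_mul _ _ hk _ ht, leading_mul _ _ hk _ (mul_mem hΦ hs), leading_mul _ _ hk _ hΦ,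
    leading_eq_zero l d n.lt_succ_self hr, add_zero] at this

/-- If `det M = -1` and `1` is not an eigenvalue of `M`, an element conjugating two elements of
`γ₄`, in the twisted sense and modulo `γ₄`, is in `γ₄`. On `γ₂/γ₃` the action is by `-1`, and in the
coordinates on `γ₃/γ₄` it is by `-M`, which fixes no nonzero vector because `-1` is not an
eigenvalue of `M`: the other one would be `1`. -/
lemma HasMatrix.mem_lcs_three {Φ : FreeGroup (Fin 2) →* FreeGroup (Fin 2)} {a b c d : ℤ}
    (h : HasMatrix Φ a b c d) (h1 : (a - 1) * (d - 1) - b * c ≠ 0) (hdet : a * d - b * c = -1)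
    {x s t r : FreeGroup (Fin 2)}
    (hs : s ∈ lcs 3) (ht : t ∈ lcs 3) (hr : r ∈ lcs 3) (hx : t * x = Φ x * s * r) :
    x ∈ lcs 3 := by
  have h13 : lcs 3 ≤ lcs 1 := lcs_le (by norm_num)
  have h23 : lcs 3 ≤ lcs 2 := lcs_le (by norm_num)
  have hx1 : x ∈ lcs 1 := h.mem_lcs_one h1 (h13 hs) (h13 ht) (h13 hr) hx
  have hx2 : x ∈ lcs 2 := by
    refine mem_lcs_two hx1 ?_
    have e := leading_twisted ![1, 0] ![0, -1] (n := 1) le_rfl hx1 (h13 hs) (h13 ht) (h23 hr) hx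
    rw [leading_eq_zero _ _ (by norm_num) hs, leading_eq_zero _ _ (by norm_num) ht] at e
    have e' := h.degTwo_map hx1
    rw [hdet] at e'
    simp only [degTwo] at e' ⊢
    linarith
  have e0 := leading_twisted ![1, 0] ![0, -1] (n := 2) one_le_two hx2 (h23 hs) (h23 ht) hr hx
  have e1 := leading_twisted ![0, 1] ![1, 0] (n := 2) one_le_two hx2 (h23 hs) (h23 ht) hr hx
  rw [leading_eq_zero _ _ (by norm_num) hs, leading_eq_zero _ _ (by norm_num) ht] at e0 e1
  have e0' := h.degThreeX_map hx2
  have e1' := h.degThreeY_map hx2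
  rw [hdet] at e0' e1'
  change 0 + degThreeX x = degThreeX (Φ x) + 0 at e0
  change 0 + degThreeY x = degThreeY (Φ x) + 0 at e1
  rw [e0'] at e0
  rw [e1'] at e1
  -- The coordinates satisfy `(M + 1) v = 0`, and `det (M + 1) = -det (M - 1)` when `det M = -1`.
  refine FreeGroupTwo.mem_lcs_three hx2 ?_ ?_
  · exact (mul_eq_zero.1 (show ((a - 1) * (d - 1) - b * c) * degThreeX x = 0 by
      linear_combination b * e1 - (d + 1) * e0 + 2 * hdet * degThreeX x)).resolve_left h1
  · exact (mul_eq_zero.1 (show ((a - 1) * (d - 1) - b * c) * degThreeY x = 0 by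
      linear_combination c * e0 - (a + 1) * e1 + 2 * hdet * degThreeY x)).resolve_left h1

end FreeGroupTwo

open FreeGroupTwo in
theorem corollary4p1 (c : ℕ) (hc : 4 ≤ c) : HasRInfinity (FreeNilpotentGroup 2 c) := by
  intro φ
  obtain ⟨Φ, hΦ⟩ := exists_lift (φ : FreeNilpotentGroup 2 c →* FreeNilpotentGroup 2 c)
  obtain ⟨p, q, r, t, h⟩ := exists_hasMatrix Φ
  by_cases h1 : (p - 1) * (t - 1) - q * r = 0
  · obtain ⟨l, i, hi, hl0, hl1⟩ := exists_fixed_functional h1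
    refine reidemeisterNumber_eq_top_of_invariant hc hΦ (of i) (pairing l) (pairing_pow l _)
      ?_ fun m n x y hy hx => ?_
    · fin_cases i <;> simpa [pairing] using hi
    · have e := congrArg (pairing l) hx
      have hl : pullback Φ l = l := by
        rw [h.pullback_eq, hl0, hl1]; ext j; fin_cases j <;> rfl
      rw [pairing_mul, pairing_mul, pairing_mul, pairing_map, hl,
        pairing_of_mem l (lcs_le (by norm_num) hy)] at e
      linarith
  rcases h.det_eq (by omega) hΦ with hdet | hdet
  · refine reidemeisterNumber_eq_top_of_invariant hc hΦ basicTwo degTwo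
      (leading_pow _ _ le_rfl _ basicTwo_mem) (by simp) fun m n x y hy hx => ?_
    have hm := fun m : ℕ => pow_mem basicTwo_mem m
    have hx1 := h.mem_lcs_one h1 (hm m) (hm n) (lcs_le (by norm_num) hy) hx
    have e := leading_twisted ![1, 0] ![0, -1] (n := 1) le_rfl hx1 (hm m) (hm n)
      (lcs_le (by norm_num) hy) hx
    have e' := h.degTwo_map hx1
    rw [hdet, one_mul] at e'
    simp only [degTwo] at e' ⊢
    linarith
  · obtain ⟨w, hw, hw0⟩ := exists_degFourInvariant_ne_zero hdet
    refine reidemeisterNumber_eq_top_of_invariant hc hΦ w (degFourInvariant p q r t)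
      (degFourInvariant_pow _ _ _ _ hw) hw0 fun m n x y hy hx => ?_
    have hm := fun m : ℕ => pow_mem hw m
    have hx3 := h.mem_lcs_three h1 hdet (hm m) (hm n) (lcs_le (by norm_num) hy) hx
    have hΦx := map_mem_lcs Φ hx3
    have e := congrArg (degFourInvariant p q r t) hx
    rw [degFourInvariant_mul _ _ _ _ (hm n), degFourInvariant_mul _ _ _ _ (mul_mem hΦx (hm m)),
      degFourInvariant_mul _ _ _ _ hΦx, degFourInvariant_of_mem _ _ _ _ hy,
      h.degFourInvariant_map hx3, hdet] at e
    linarith
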